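/- Let $(\Gamma,S)$ be a Coxeter system with $S$ finite; that is, $\Gamma$ is a group with a presentation with finite generating set $S=\{s_\alpha\}_{\alpha}$ and relations $(s_\alpha s_\beta)^{m_{\alpha\beta}}=1$, where $m_{\alpha\alpha}=1$, $m_{\alpha\beta}=m_{\beta\alpha}\in\{2,3,\dots\}\cup\{\infty\}$ for $\alpha\neq\beta$, and the relations with $m_{\alpha\beta}=\infty$ are omitted. Then for every element $\gamma\in\Gamma$ of finite order there is a subset $S'\subseteq S$ such that the subgroup $\langle S'\rangle$ generated by $S'$ is finite and $\gamma$ is conjugate in $\Gamma$ to an element of $\langle S'\rangle$. -/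

import Mathlib

/-! Let Γ act on the dual of its geometric representation. Averaging a functional positive on all
simple roots over the powers of γ gives a γ-invariant f. Each group element makes only finitely many
positive roots negative (`finite_inversions`), so f is positive on almost all positive roots: it
lies in the interior of the Tits cone. Some w moves f into the closed fundamental chamber
(`exists_dominant`), where the stabilizer is a standard parabolic subgroup
(`mem_closure_iff_of_dominant`). This is finite because only finitely many roots vanish on the
functional (`finite_closure_of_dominant`), and it contains w⁻¹γw. All of this rests on every root
being positive or negative (`geomRep_simpleRoot_nonneg`). -/

namespace CoxeterMatrix

open Polynomial.Chebyshev

variable {B : Type*} (M : CoxeterMatrix B)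

/-! ### Simple reflections and the Coxeter relations -/

/-- The simple coroots, as functionals on the space of the geometric representation. -/
noncomputable def simpleCoroot (i : B) : Module.Dual ℝ (B →₀ ℝ) :=
  Finsupp.linearCombination ℝ fun j ↦ -2 * Real.cos (Real.pi / M i j)

/-- The simple roots. -/
noncomputable def simpleRoot (_M : CoxeterMatrix B) (i : B) : B →₀ ℝ := Finsupp.single i 1

theorem simpleCoroot_simpleRoot (i j : B) :
    M.simpleCoroot i (M.simpleRoot j) = -2 * Real.cos (Real.pi / M i j) := by
  simp [simpleCoroot, simpleRoot]

theorem simpleCoroot_simpleRoot_comm (i j : B) :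
    M.simpleCoroot i (M.simpleRoot j) = M.simpleCoroot j (M.simpleRoot i) := by
  rw [simpleCoroot_simpleRoot, simpleCoroot_simpleRoot, M.symmetric i j]

@[simp]
theorem simpleCoroot_simpleRoot_self (i : B) : M.simpleCoroot i (M.simpleRoot i) = 2 := by
  simp [simpleCoroot_simpleRoot]

theorem simpleRoot_nonneg (i : B) : 0 ≤ M.simpleRoot i := by
  simp [simpleRoot]

theorem simpleRoot_ne_zero (i : B) : M.simpleRoot i ≠ 0 := by
  simp [simpleRoot]

/-- The reflection in a simple root. -/
noncomputable def simpleReflection (i : B) : (B →₀ ℝ) ≃ₗ[ℝ] (B →₀ ℝ) :=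
  Module.reflection (M.simpleCoroot_simpleRoot_self i)

theorem simpleReflection_apply (i : B) (v : B →₀ ℝ) :
    M.simpleReflection i v = v - M.simpleCoroot i v • M.simpleRoot i :=
  Module.reflection_apply ..

/-- For finite m ≥ 2 the product of two simple reflections rotates the plane of their roots by θ =
2π/m. Its powers are given by Chebyshev polynomials at 2 cos θ, and the relevant combinations vanish
at the m-th power. -/
theorem isLiftable_simpleReflection : M.IsLiftable M.simpleReflection := by
  intro i j
  rcases eq_or_ne i j with rfl | hij
  · rw [M.diagonal, pow_one]
    refine LinearEquiv.ext fun v ↦ ?_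
    rw [LinearEquiv.mul_apply]
    exact Module.involutive_reflection (M.simpleCoroot_simpleRoot_self i) v
  set m := M i j
  -- The entry 0 encodes m = ∞.
  rcases Nat.eq_zero_or_pos m with h0 | hpos
  · rw [h0, pow_zero]
  have hm1 : m ≠ 1 := M.off_diagonal i j hij
  set c := Real.cos (Real.pi / m) with hc
  have hij' : M.simpleCoroot i (M.simpleRoot j) = -2 * c := M.simpleCoroot_simpleRoot i j
  have hji' : M.simpleCoroot j (M.simpleRoot i) = -2 * c := by
    rw [simpleCoroot_simpleRoot_comm, hij']
  refine LinearEquiv.ext fun v ↦ ?_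
  rw [simpleReflection, simpleReflection, Module.reflection_mul_reflection_pow_apply, hij', hji',
    LinearEquiv.coe_one, id]
  -- For m = 2, sin θ = 0 and the quotient formula `key` is unavailable.
  rcases eq_or_ne m 2 with h2 | hm2
  · have hc0 : c = 0 := by rw [hc, h2]; simp
    rw [h2, hc0]
    norm_num
    module
  set θ := 2 * Real.pi / m with hθ
  have hm3 : (3 : ℝ) ≤ m := by exact_mod_cast (by omega : 3 ≤ m)
  have hsin : Real.sin θ ≠ 0 := by
    apply ne_of_gt
    apply Real.sin_pos_of_pos_of_lt_pi (by positivity)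
    rw [hθ, div_lt_iff₀ (by positivity)]
    nlinarith [Real.pi_pos]
  have ht : -2 * c * (-2 * c) - 2 = 2 * Real.cos θ := by
    rw [hθ, mul_div_assoc, Real.cos_two_mul]; ring
  rw [ht]
  have key (n : ℤ) : (S ℝ n).eval (2 * Real.cos θ) = Real.sin ((n + 1) * θ) / Real.sin θ := by
    rw [eq_div_iff hsin, S_two_mul_real_cos]
  have hmθ : m * θ = 2 * Real.pi := by rw [hθ]; field_simp
  obtain ⟨k, hk | hk⟩ := Nat.even_or_odd' m
  · have e1 : ((m : ℤ) - 2) / 2 = k - 1 := by omega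
    have e2 : ((m : ℤ) - 1) / 2 = k - 1 := by omega
    have h0 : (S ℝ (k - 1)).eval (2 * Real.cos θ) = 0 := by
      rw [key]
      have : (((k : ℤ) - 1 : ℤ) + 1 : ℝ) * θ = Real.pi := by
        rw [hk] at hmθ; push_cast at hmθ ⊢; linarith
      rw [this]; simp
    rw [e1, e2, h0]
    simp
  · have e1 : ((m : ℤ) - 2) / 2 = k - 1 := by omega
    have e2 : ((m : ℤ) - 1) / 2 = k := by omega
    have e3 : (m : ℤ) / 2 = k := by omega
    have e4 : ((m : ℤ) - 3) / 2 = k - 1 := by omega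
    have h0 : (S ℝ k).eval (2 * Real.cos θ) + (S ℝ (k - 1)).eval (2 * Real.cos θ) = 0 := by
      rw [key, key, ← add_div]
      have : (((k : ℤ) : ℝ) + 1) * θ = 2 * Real.pi - (((k : ℤ) - 1 : ℤ) + 1 : ℝ) * θ := by
        rw [hk] at hmθ; push_cast at hmθ ⊢; linarith
      rw [this, Real.sin_two_pi_sub]; simp
    rw [e1, e2, e3, e4, h0]
    simp

/-! ### Invariant form and dihedral coefficients -/

/-- The invariant symmetric bilinear form, normalized so that every root has square length two. -/
noncomputable def rootForm : (B →₀ ℝ) →ₗ[ℝ] Module.Dual ℝ (B →₀ ℝ) :=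
  Finsupp.linearCombination ℝ M.simpleCoroot

@[simp]
theorem rootForm_simpleRoot (i : B) : M.rootForm (M.simpleRoot i) = M.simpleCoroot i := by
  simp [rootForm, simpleRoot]

theorem rootForm_simpleRoot_right (v : B →₀ ℝ) (i : B) :
    M.rootForm v (M.simpleRoot i) = M.simpleCoroot i v := by
  suffices M.rootForm.flip (M.simpleRoot i) = M.simpleCoroot i from LinearMap.congr_fun this v
  ext j
  have := M.simpleCoroot_simpleRoot_comm j i
  rw [← rootForm_simpleRoot] at this
  simpa [simpleRoot] using this

theorem rootForm_simpleReflection (i : B) (v w : B →₀ ℝ) :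
    M.rootForm (M.simpleReflection i v) (M.simpleReflection i w) = M.rootForm v w := by
  simp only [simpleReflection_apply, map_sub, map_smul, LinearMap.sub_apply, LinearMap.smul_apply,
    rootForm_simpleRoot, rootForm_simpleRoot_right, simpleCoroot_simpleRoot_self, smul_eq_mul]
  ring

/-- The coefficients arising in the action of a dihedral group on its simple roots. -/
noncomputable def dihedralCoeff (m n : ℕ) : ℝ :=
  (S ℝ (n - 1)).eval (2 * Real.cos (Real.pi / m))

theorem dihedralCoeff_zero (m : ℕ) : dihedralCoeff m 0 = 0 := by
  simp [dihedralCoeff]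

theorem dihedralCoeff_one (m : ℕ) : dihedralCoeff m 1 = 1 := by
  simp [dihedralCoeff]

theorem dihedralCoeff_add_two (m n : ℕ) : dihedralCoeff m (n + 2) =
    2 * Real.cos (Real.pi / m) * dihedralCoeff m (n + 1) - dihedralCoeff m n := by
  have := congrArg (Polynomial.eval (2 * Real.cos (Real.pi / m))) (S_add_two ℝ ((n : ℤ) - 1))
  rw [Polynomial.eval_sub, Polynomial.eval_mul, Polynomial.eval_X] at this
  unfold dihedralCoeff
  rw [show ((n + 2 : ℕ) : ℤ) - 1 = n - 1 + 2 by push_cast; ring,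
    show ((n + 1 : ℕ) : ℤ) - 1 = n - 1 + 1 by push_cast; ring]
  exact this

/-- For m ≥ 2 the coefficient is sin(nπ/m) / sin(π/m). For m = 0, the convention π/0 = 0 turns it
into S_{n-1}(2) = n. -/
theorem dihedralCoeff_nonneg {m n : ℕ} (hm : m ≠ 1) (h : m ≠ 0 → n ≤ m) :
    0 ≤ dihedralCoeff m n := by
  rcases Nat.eq_zero_or_pos m with rfl | hpos
  · simp [dihedralCoeff]
  have h2 : (2 : ℝ) ≤ m := by exact_mod_cast (by omega : 2 ≤ m)
  have hn : (n : ℝ) ≤ m := by exact_mod_cast h hpos.ne'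
  have hsin : 0 < Real.sin (Real.pi / m) := by
    apply Real.sin_pos_of_pos_of_lt_pi (by positivity)
    rw [div_lt_iff₀ (by positivity)]
    nlinarith [Real.pi_pos]
  refine nonneg_of_mul_nonneg_left ?_ hsin
  rw [dihedralCoeff, S_two_mul_real_cos]
  apply Real.sin_nonneg_of_nonneg_of_le_pi
  · push_cast
    rw [sub_add_cancel]
    positivity
  · push_cast
    rw [sub_add_cancel, mul_div_assoc', div_le_iff₀ (by positivity)]
    nlinarith [Real.pi_pos]

end CoxeterMatrix

namespace CoxeterSystem

open CoxeterMatrix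

variable {B : Type*} {M : CoxeterMatrix B} {W : Type*} [Group W] (cs : CoxeterSystem M W)

/-! ### The geometric representation and the sign of roots -/

/-- The geometric representation of a Coxeter group. -/
noncomputable def geomRep : W →* ((B →₀ ℝ) ≃ₗ[ℝ] (B →₀ ℝ)) :=
  cs.lift ⟨M.simpleReflection, M.isLiftable_simpleReflection⟩

theorem geomRep_simple (i : B) : cs.geomRep (cs.simple i) = M.simpleReflection i :=
  cs.lift_apply_simple _ i

theorem geomRep_simple_apply (i : B) (v : B →₀ ℝ) :
    cs.geomRep (cs.simple i) v = v - M.simpleCoroot i v • M.simpleRoot i := by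
  rw [geomRep_simple, simpleReflection_apply]

theorem geomRep_mul_apply (u w : W) (v : B →₀ ℝ) :
    cs.geomRep (u * w) v = cs.geomRep u (cs.geomRep w v) := by
  rw [map_mul, LinearEquiv.mul_apply]

theorem geomRep_mul_simple_simpleRoot (w : W) (i : B) :
    cs.geomRep (w * cs.simple i) (M.simpleRoot i) = -cs.geomRep w (M.simpleRoot i) := by
  rw [geomRep_mul_apply, geomRep_simple_apply, simpleCoroot_simpleRoot_self, ← map_neg]
  congr 1
  module

theorem rootForm_geomRep (w : W) (v v' : B →₀ ℝ) :
    M.rootForm (cs.geomRep w v) (cs.geomRep w v') = M.rootForm v v' := by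
  induction w using cs.simple_induction_left with
  | one => simp
  | mul_simple_left w i ih =>
    rw [geomRep_mul_apply, geomRep_mul_apply, geomRep_simple, rootForm_simpleReflection, ih]

theorem geomRep_alternatingWord (i j : B) (n : ℕ) :
    cs.geomRep (cs.wordProd (alternatingWord i j n)) (M.simpleRoot i) =
      if Even n then
        dihedralCoeff (M i j) (n + 1) • M.simpleRoot i + dihedralCoeff (M i j) n • M.simpleRoot j
      else
        dihedralCoeff (M i j) n • M.simpleRoot i +
          dihedralCoeff (M i j) (n + 1) • M.simpleRoot j := by
  induction n with
  | zero => simp [alternatingWord, dihedralCoeff_zero, dihedralCoeff_one]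
  | succ n ih =>
    rw [alternatingWord_succ', wordProd_cons, geomRep_mul_apply, ih, geomRep_simple_apply,
      dihedralCoeff_add_two]
    by_cases h : Even n
    · have h' : ¬ Even (n + 1) := by simp [h, parity_simps]
      simp only [h, h', if_true, if_false, map_add, map_smul, simpleCoroot_simpleRoot_self,
        M.simpleCoroot_simpleRoot j i, M.symmetric j i, smul_eq_mul]
      module
    · have h' : Even (n + 1) := by simp [h, parity_simps]
      simp only [h, h', if_true, if_false, map_add, map_smul, simpleCoroot_simpleRoot_self,
        M.simpleCoroot_simpleRoot i j, smul_eq_mul]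
      module

theorem length_mul_wordProd_le (v : W) (ω : List B) :
    cs.length (v * cs.wordProd ω) ≤ cs.length v + ω.length :=
  (cs.length_mul_le _ _).trans (Nat.add_le_add_left (cs.length_wordProd_le ω) _)

/-- A reduced factorization `w = v * u`, with `u` an alternating word in `i` and `j` which is
nontrivial if `j` is a right descent of `w`, and `v` without right descents in `{i, j}`. -/
theorem exists_eq_mul_alternatingWord {w : W} {i j : B} (hi : ¬ cs.IsRightDescent w i)
    (hj : cs.IsRightDescent w j) :
    ∃ (v : W) (n : ℕ), w = v * cs.wordProd (alternatingWord i j n) ∧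
      cs.length v < cs.length w ∧ (M i j ≠ 0 → n < M i j) ∧
      ¬ cs.IsRightDescent v i ∧ ¬ cs.IsRightDescent v j := by
  let P (n : ℕ) : Prop := ∃ v : W, w = v * cs.wordProd (alternatingWord i j n) ∧
    cs.length w = cs.length v + n
  have h1 : P 1 := ⟨w * cs.simple j, by simp [alternatingWord],
    (cs.isRightDescent_iff.1 hj).symm⟩
  -- The alternating suffix is taken of maximal length; its length is bounded by that of w.
  obtain ⟨k, ⟨v, hv, hlen⟩, hmax⟩ : ∃ k, P (k + 1) ∧ ¬ P (k + 2) := by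
    by_contra! h
    have hall (k : ℕ) : P (k + 1) := by
      induction k with
      | zero => exact h1
      | succ k ih => exact h k ih
    obtain ⟨v, -, hv⟩ := hall (cs.length w)
    omega
  have hletter : ¬ cs.IsRightDescent v (if Even (k + 1) then j else i) := by
    intro h
    refine hmax ⟨v * cs.simple (if Even (k + 1) then j else i), ?_, ?_⟩
    · rw [alternatingWord_succ', wordProd_cons, mul_assoc, simple_mul_simple_cancel_left, ← hv]
    · rw [cs.isRightDescent_iff] at h
      omega
  -- If the letter just stripped were a descent of v, w would have a factorization shorter than its
  -- length.
  have hletter' : ¬ cs.IsRightDescent v (if Even k then j else i) := by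
    intro h
    rw [alternatingWord_succ', wordProd_cons, ← mul_assoc] at hv
    have := cs.length_mul_wordProd_le (v * cs.simple (if Even k then j else i))
      (alternatingWord i j k)
    rw [← hv, length_alternatingWord] at this
    rw [cs.isRightDescent_iff] at h
    omega
  refine ⟨v, k + 1, hv, by omega, ?_, ?_, ?_⟩
  · intro hM
    by_contra! hk
    rcases hk.lt_or_eq with hlt | heq
    · apply cs.not_isReduced_alternatingWord i j hM hlt
      have h2 := cs.length_mul_le v (cs.wordProd (alternatingWord i j (k + 1)))
      have h3 := cs.length_wordProd_le (alternatingWord i j (k + 1))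
      rw [← hv] at h2
      rw [length_alternatingWord] at h3
      rw [IsReduced, length_alternatingWord]
      omega
    -- When n = M i j, the braid relation rewrites the suffix to end in i, making i a right descent
    -- of w.
    · apply hi
      have hbraid := cs.wordProd_braidWord_eq i j
      rw [braidWord, braidWord, M.symmetric j i, heq] at hbraid
      rw [hbraid, alternatingWord_succ, wordProd_concat, ← mul_assoc] at hv
      have := cs.length_mul_wordProd_le v (alternatingWord i j k)
      rw [length_alternatingWord] at this
      rw [IsRightDescent, hlen, hv, simple_mul_simple_cancel_right]
      omega
  · by_cases h : Even k
    · simpa [h, parity_simps] using hletter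
    · simpa [h] using hletter'
  · by_cases h : Even k
    · simpa [h] using hletter'
    · simpa [h, parity_simps] using hletter

/-- Factor w = v * u with u dihedral: u sends the root of i to a nonnegative combination of the
roots of i and j, and by induction on length v keeps both nonnegative. -/
theorem geomRep_simpleRoot_nonneg {w : W} {i : B} (h : ¬ cs.IsRightDescent w i) :
    0 ≤ cs.geomRep w (M.simpleRoot i) := by
  induction hn : cs.length w using Nat.strong_induction_on generalizing w i with
  | _ n ih =>
  rcases eq_or_ne w 1 with rfl | hw
  · simpa using M.simpleRoot_nonneg i
  obtain ⟨j, hj⟩ := cs.exists_rightDescent_of_ne_one hw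
  have hij : i ≠ j := by rintro rfl; exact h hj
  obtain ⟨v, n, hv, hlt, hM, hvi, hvj⟩ := cs.exists_eq_mul_alternatingWord h hj
  have hi := ih _ (hn ▸ hlt) hvi rfl
  have hj := ih _ (hn ▸ hlt) hvj rfl
  have c1 : 0 ≤ dihedralCoeff (M i j) n :=
    dihedralCoeff_nonneg (M.off_diagonal i j hij) fun h ↦ (hM h).le
  have c2 : 0 ≤ dihedralCoeff (M i j) (n + 1) :=
    dihedralCoeff_nonneg (M.off_diagonal i j hij) fun h ↦ hM h
  rw [hv, geomRep_mul_apply, geomRep_alternatingWord]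
  split_ifs
  all_goals
    rw [map_add, map_smul, map_smul]
    exact add_nonneg (smul_nonneg ‹_› hi) (smul_nonneg ‹_› hj)

theorem geomRep_simpleRoot_nonpos {w : W} {i : B} (h : cs.IsRightDescent w i) :
    cs.geomRep w (M.simpleRoot i) ≤ 0 := by
  have := cs.geomRep_simpleRoot_nonneg (cs.isRightDescent_iff_not_isRightDescent_mul.1 h)
  rw [geomRep_mul_simple_simpleRoot] at this
  exact neg_nonneg.1 this

/-! ### Roots and inversions -/

/-- The set of roots: the orbits of the simple roots in the geometric representation. -/
def roots : Set (B →₀ ℝ) := {β | ∃ w i, cs.geomRep w (M.simpleRoot i) = β}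

theorem simpleRoot_mem_roots (i : B) : M.simpleRoot i ∈ cs.roots := ⟨1, i, by simp⟩

variable {cs} {β : B →₀ ℝ}

theorem geomRep_mem_roots (w : W) (hβ : β ∈ cs.roots) : cs.geomRep w β ∈ cs.roots := by
  obtain ⟨u, i, rfl⟩ := hβ
  exact ⟨w * u, i, cs.geomRep_mul_apply w u _⟩

theorem neg_mem_roots (hβ : β ∈ cs.roots) : -β ∈ cs.roots := by
  obtain ⟨u, i, rfl⟩ := hβ
  exact ⟨u * cs.simple i, i, cs.geomRep_mul_simple_simpleRoot u i⟩

theorem ne_zero_of_mem_roots (hβ : β ∈ cs.roots) : β ≠ 0 := by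
  obtain ⟨u, i, rfl⟩ := hβ
  simpa using M.simpleRoot_ne_zero i

theorem nonneg_or_nonpos_of_mem_roots (hβ : β ∈ cs.roots) : 0 ≤ β ∨ β ≤ 0 := by
  obtain ⟨u, i, rfl⟩ := hβ
  by_cases h : cs.IsRightDescent u i
  · exact .inr (cs.geomRep_simpleRoot_nonpos h)
  · exact .inl (cs.geomRep_simpleRoot_nonneg h)

theorem rootForm_self_of_mem_roots (hβ : β ∈ cs.roots) : M.rootForm β β = 2 := by
  obtain ⟨u, i, rfl⟩ := hβ
  simp [rootForm_geomRep]

/-- A simple reflection permutes the positive roots other than its own root. -/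
theorem geomRep_simple_nonneg {i : B} (hβ : β ∈ cs.roots) (h0 : 0 ≤ β)
    (hi : β ≠ M.simpleRoot i) : 0 ≤ cs.geomRep (cs.simple i) β := by
  refine (nonneg_or_nonpos_of_mem_roots (geomRep_mem_roots (cs.simple i) hβ)).resolve_right ?_
  intro hneg
  -- The reflection changes only the i-th coordinate, so a sign change confines β to that
  -- coordinate; its square length 2 then fixes the scalar.
  have hβi : β = β i • M.simpleRoot i := by
    ext j
    rcases eq_or_ne j i with rfl | hj
    · simp [simpleRoot]
    · have h1 := hneg j
      have h2 := h0 j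
      simp only [geomRep_simple_apply, simpleRoot, Finsupp.coe_sub, Finsupp.coe_smul,
        Pi.sub_apply, Pi.smul_apply, Finsupp.single_eq_of_ne hj, smul_zero, sub_zero,
        Finsupp.coe_zero, Pi.zero_apply] at h1 h2 ⊢
      exact le_antisymm h1 h2
  have hform := rootForm_self_of_mem_roots hβ
  rw [hβi] at hform
  simp only [map_smul, LinearMap.smul_apply, rootForm_simpleRoot, simpleCoroot_simpleRoot_self,
    smul_eq_mul] at hform
  have hb : 0 ≤ β i := h0 i
  have : β i = 1 := by nlinarith
  rw [this, one_smul] at hβi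
  exact hi hβi

-- Left multiplication by a simple reflection creates at most one new inversion, the root that w
-- sends to the simple root.
variable (cs) in
theorem finite_inversions (w : W) : {β ∈ cs.roots | 0 ≤ β ∧ ¬ 0 ≤ cs.geomRep w β}.Finite := by
  induction w using cs.simple_induction_left with
  | one =>
    convert Set.finite_empty
    ext β
    simp +contextual
  | mul_simple_left w i ih =>
    refine (ih.union (Set.finite_singleton ((cs.geomRep w).symm (M.simpleRoot i)))).subset ?_
    rintro β ⟨hβ, h0, hneg⟩
    by_cases h : 0 ≤ cs.geomRep w β
    · right
      rw [Set.mem_singleton_iff, LinearEquiv.eq_symm_apply]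
      by_contra hne
      rw [geomRep_mul_apply] at hneg
      exact hneg (geomRep_simple_nonneg (geomRep_mem_roots w hβ) h hne)
    · exact .inl ⟨hβ, h0, h⟩

/-! ### Dominant functionals and their stabilizers -/

theorem _root_.CoxeterMatrix.dual_apply_nonneg {f : Module.Dual ℝ (B →₀ ℝ)}
    (hf : ∀ i, 0 ≤ f (M.simpleRoot i)) {v : B →₀ ℝ} (hv : 0 ≤ v) : 0 ≤ f v := by
  rw [← Finsupp.sum_single v, Finsupp.sum, map_sum]
  refine Finset.sum_nonneg fun i _ ↦ ?_
  have : Finsupp.single i (v i) = v i • M.simpleRoot i := by simp [simpleRoot]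
  rw [this, map_smul]
  exact smul_nonneg (hv i) (hf i)

theorem _root_.CoxeterMatrix.dual_apply_pos {f : Module.Dual ℝ (B →₀ ℝ)}
    (hf : ∀ i, 0 < f (M.simpleRoot i)) {v : B →₀ ℝ} (hv : 0 ≤ v) (hv0 : v ≠ 0) : 0 < f v := by
  rw [← Finsupp.sum_single v, Finsupp.sum, map_sum]
  refine Finset.sum_pos (fun i hi ↦ ?_) (Finsupp.support_nonempty_iff.2 hv0)
  have : Finsupp.single i (v i) = v i • M.simpleRoot i := by simp [simpleRoot]
  rw [this, map_smul]
  exact smul_pos ((hv i).lt_of_ne (Finsupp.mem_support_iff.1 hi).symm) (hf i)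

variable {f : Module.Dual ℝ (B →₀ ℝ)}

/-- A functional which is negative on only finitely many positive roots can be moved into the
closed fundamental chamber. -/
theorem exists_dominant
    (hf : {β ∈ cs.roots | 0 ≤ β ∧ f β < 0}.Finite) :
    ∃ w : W, ∀ i, 0 ≤ f (cs.geomRep w (M.simpleRoot i)) := by
  induction hn : {β ∈ cs.roots | 0 ≤ β ∧ f β < 0}.ncard
    using Nat.strong_induction_on generalizing f with
  | _ n ih =>
  by_cases h : ∀ i, 0 ≤ f (M.simpleRoot i)
  · exact ⟨1, by simpa using h⟩
  push Not at h
  obtain ⟨i, hi⟩ := h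
  let g : Module.Dual ℝ (B →₀ ℝ) := f ∘ₗ (cs.geomRep (cs.simple i)).toLinearMap
  have hinj : Function.Injective (cs.geomRep (cs.simple i)) := LinearEquiv.injective _
  -- Reflecting in a simple root where f is negative removes that root from the negative set and
  -- only permutes the others, so the count drops.
  have himage : cs.geomRep (cs.simple i) '' {β ∈ cs.roots | 0 ≤ β ∧ g β < 0} ⊂
      {β ∈ cs.roots | 0 ≤ β ∧ f β < 0} := by
    have hgi : 0 < g (M.simpleRoot i) := by
      have := cs.geomRep_mul_simple_simpleRoot 1 i
      simp only [one_mul, map_one, LinearEquiv.coe_one, id] at this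
      simpa [g, this] using hi
    rw [Set.ssubset_iff_exists]
    refine ⟨?_, M.simpleRoot i, ⟨cs.simpleRoot_mem_roots i, M.simpleRoot_nonneg i, hi⟩, ?_⟩
    · rintro _ ⟨β, ⟨hβ, h0, hneg⟩, rfl⟩
      exact ⟨geomRep_mem_roots _ hβ,
        geomRep_simple_nonneg hβ h0 fun h ↦ (h ▸ hneg).not_gt hgi, hneg⟩
    · rintro ⟨β, ⟨hβ, h0, hneg⟩, h⟩
      have : β = -M.simpleRoot i := by
        apply hinj
        have := cs.geomRep_mul_simple_simpleRoot 1 i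
        simp only [one_mul, map_one, LinearEquiv.coe_one, id] at this
        rw [h, map_neg, this, neg_neg]
      have h1 : M.simpleRoot i ≤ 0 := by rw [this] at h0; exact neg_nonneg.1 h0
      exact M.simpleRoot_ne_zero i (le_antisymm h1 (M.simpleRoot_nonneg i))
  have hlt := Set.ncard_lt_ncard himage hf
  rw [Set.ncard_image_of_injective _ hinj, hn] at hlt
  have hfin : {β ∈ cs.roots | 0 ≤ β ∧ g β < 0}.Finite :=
    (hf.subset himage.subset).of_finite_image hinj.injOn
  obtain ⟨w, hw⟩ := ih _ hlt hfin rfl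
  exact ⟨cs.simple i * w, fun j ↦ by simpa [g, geomRep_mul_apply] using hw j⟩

/-- The simple reflections at the right descents of an element fixing a dominant functional also fix
that functional. -/
theorem apply_simpleRoot_eq_zero_of_isRightDescent (hf : ∀ i, 0 ≤ f (M.simpleRoot i)) {w : W}
    (hw : ∀ v, f (cs.geomRep w v) = f v) {i : B} (hi : cs.IsRightDescent w i) :
    f (M.simpleRoot i) = 0 := by
  refine le_antisymm ?_ (hf i)
  have := M.dual_apply_nonneg hf (neg_nonneg.2 (cs.geomRep_simpleRoot_nonpos hi))
  rw [map_neg, hw] at this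
  exact neg_nonneg.1 this

theorem apply_geomRep_simple_of_apply_eq_zero {i : B} (hi : f (M.simpleRoot i) = 0)
    (v : B →₀ ℝ) : f (cs.geomRep (cs.simple i) v) = f v := by
  simp [geomRep_simple_apply, hi]

/-- The stabilizer of a dominant functional is the corresponding standard parabolic subgroup. -/
theorem mem_closure_iff_of_dominant (hf : ∀ i, 0 ≤ f (M.simpleRoot i)) {w : W} :
    w ∈ Subgroup.closure (cs.simple '' {i | f (M.simpleRoot i) = 0}) ↔
      ∀ v, f (cs.geomRep w v) = f v := by
  constructor
  · intro h
    induction h using Subgroup.closure_induction with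
    | mem x hx =>
      obtain ⟨i, hi, rfl⟩ := hx
      exact apply_geomRep_simple_of_apply_eq_zero hi
    | one => simp
    | mul x y _ _ hx hy => intro v; rw [geomRep_mul_apply, hx, hy]
    | inv x _ hx => intro v; rw [← hx (cs.geomRep x⁻¹ v), ← geomRep_mul_apply]; simp
  · intro h
    induction hn : cs.length w using Nat.strong_induction_on generalizing w with
    | _ n ih =>
    rcases eq_or_ne w 1 with rfl | hw
    · exact one_mem _
    obtain ⟨i, hi⟩ := cs.exists_rightDescent_of_ne_one hw
    have hi0 := apply_simpleRoot_eq_zero_of_isRightDescent hf h hi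
    have := ih _ (hn ▸ hi) (w := w * cs.simple i) (fun v ↦ by
      rw [geomRep_mul_apply, h, apply_geomRep_simple_of_apply_eq_zero hi0]) rfl
    rw [← cs.simple_mul_simple_cancel_right (w := w) i]
    exact mul_mem this (Subgroup.subset_closure ⟨i, hi0, rfl⟩)

/-- An element of the parabolic subgroup is determined by where it sends the simple roots killed by
f: a nontrivial element has a right descent among them and makes that root negative. -/
theorem finite_closure_of_dominant [Finite B] (hf : ∀ i, 0 ≤ f (M.simpleRoot i))
    (hfin : {β ∈ cs.roots | f β = 0}.Finite) :
    Finite (Subgroup.closure (cs.simple '' {i | f (M.simpleRoot i) = 0})) := by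
  have := hfin.to_subtype
  let I := {i | f (M.simpleRoot i) = 0}
  let φ (w : Subgroup.closure (cs.simple '' I)) (i : I) : {β ∈ cs.roots | f β = 0} :=
    ⟨cs.geomRep w (M.simpleRoot i), geomRep_mem_roots _ (cs.simpleRoot_mem_roots i),
      ((mem_closure_iff_of_dominant hf).1 w.2 _).trans i.2⟩
  refine Finite.of_injective φ fun u w huw ↦ ?_
  rw [← inv_mul_eq_one]
  by_contra hne
  obtain ⟨i, hi⟩ := cs.exists_rightDescent_of_ne_one (w := ((u⁻¹ * w : _) : W))
    fun h ↦ hne (Subtype.ext h)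
  have hi0 := apply_simpleRoot_eq_zero_of_isRightDescent hf
    ((mem_closure_iff_of_dominant hf).1 (u⁻¹ * w).2) hi
  have h1 := congrArg Subtype.val (congrFun huw ⟨i, hi0⟩)
  have h2 : cs.geomRep ((u⁻¹ * w : _) : W) (M.simpleRoot i) = M.simpleRoot i := by
    change cs.geomRep u (M.simpleRoot i) = cs.geomRep w (M.simpleRoot i) at h1
    rw [Subgroup.coe_mul, geomRep_mul_apply, ← h1, ← geomRep_mul_apply]
    simp
  have h3 := cs.geomRep_simpleRoot_nonpos hi
  rw [h2] at h3
  exact M.simpleRoot_ne_zero i (le_antisymm h3 (M.simpleRoot_nonneg i))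

/-! ### The invariant functional and the conclusion -/

variable (cs) in
/-- A finite-order element fixes a functional that is positive on almost all positive roots. -/
theorem exists_invariant_dual {γ : W} (hγ : IsOfFinOrder γ) :
    ∃ f : Module.Dual ℝ (B →₀ ℝ), (∀ v, f (cs.geomRep γ v) = f v) ∧
      {β ∈ cs.roots | 0 ≤ β ∧ f β ≤ 0}.Finite := by
  let x : Module.Dual ℝ (B →₀ ℝ) := Finsupp.linearCombination ℝ fun _ ↦ 1
  have hx (i : B) : 0 < x (M.simpleRoot i) := by simp [x, simpleRoot]
  let f : Module.Dual ℝ (B →₀ ℝ) :=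
    ∑ k ∈ Finset.range (orderOf γ), x ∘ₗ (cs.geomRep (γ ^ k)).toLinearMap
  have hf (v : B →₀ ℝ) : f v = ∑ k ∈ Finset.range (orderOf γ), x (cs.geomRep (γ ^ k) v) := by
    simp [f]
  refine ⟨f, fun v ↦ ?_, ?_⟩
  · simp_rw [hf, ← geomRep_mul_apply, ← pow_succ]
    have h1 := Finset.sum_range_succ (fun k ↦ x (cs.geomRep (γ ^ k) v)) (orderOf γ)
    rw [Finset.sum_range_succ', pow_orderOf_eq_one, pow_zero] at h1
    exact add_right_cancel h1
  -- Outside the inversions of the powers of γ, every summand of f is positive.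
  · refine ((Finset.range (orderOf γ)).finite_toSet.biUnion
      fun k _ ↦ cs.finite_inversions (γ ^ k)).subset ?_
    rintro β ⟨hβ, h0, hle⟩
    by_contra hcon
    simp only [Set.mem_iUnion, not_exists, Set.mem_ofPred_eq, not_and, not_not] at hcon
    refine hle.not_gt ?_
    rw [hf]
    refine Finset.sum_pos (fun k hk ↦ ?_) (by simpa using hγ.orderOf_pos.ne')
    exact M.dual_apply_pos hx (hcon k hk hβ h0)
      (ne_zero_of_mem_roots (geomRep_mem_roots _ hβ))

end CoxeterSystem

open CoxeterSystem in
theorem mainTheorem4 {B : Type*} [Finite B] {M : CoxeterMatrix B} {Γ : Type*} [Group Γ]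
    (cs : CoxeterSystem M Γ) (γ : Γ) (hγ : IsOfFinOrder γ) :
    ∃ S' : Set Γ, S' ⊆ Set.range cs.simple ∧ Finite (Subgroup.closure S') ∧
      ∃ h ∈ Subgroup.closure S', IsConj γ h := by
  obtain ⟨f, hinv, hfin⟩ := cs.exists_invariant_dual hγ
  obtain ⟨w, hw⟩ := exists_dominant (hfin.subset fun β hβ ↦ ⟨hβ.1, hβ.2.1, hβ.2.2.le⟩)
  let g : Module.Dual ℝ (B →₀ ℝ) := f ∘ₗ (cs.geomRep w).toLinearMap
  have hg : ∀ i, 0 ≤ g (M.simpleRoot i) := hw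
  have hzero : {β ∈ cs.roots | f β = 0}.Finite := by
    refine (hfin.union (hfin.image Neg.neg)).subset ?_
    rintro β ⟨hβ, h0⟩
    rcases nonneg_or_nonpos_of_mem_roots hβ with h | h
    · exact .inl ⟨hβ, h, h0.le⟩
    · exact .inr ⟨-β, ⟨neg_mem_roots hβ, neg_nonneg.2 h, by simp [h0]⟩, neg_neg β⟩
  have hgzero : {β ∈ cs.roots | g β = 0}.Finite := by
    refine Set.Finite.of_finite_image (f := cs.geomRep w) (hzero.subset ?_)
      (LinearEquiv.injective _).injOn
    rintro _ ⟨β, ⟨hβ, h0⟩, rfl⟩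
    exact ⟨geomRep_mem_roots w hβ, h0⟩
  refine ⟨cs.simple '' {i | g (M.simpleRoot i) = 0}, Set.image_subset_range _ _,
    finite_closure_of_dominant hg hgzero, w⁻¹ * γ * w, ?_, ?_⟩
  · rw [mem_closure_iff_of_dominant hg]
    intro v
    change f (cs.geomRep w (cs.geomRep (w⁻¹ * γ * w) v)) = f (cs.geomRep w v)
    rw [← geomRep_mul_apply, mul_assoc, mul_inv_cancel_left, geomRep_mul_apply, hinv]
  · exact isConj_iff.2 ⟨w⁻¹, by simp⟩
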